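/- For a finite set $A\subset\mathbb Z$ and $m\in\mathbb Z$ let $r_A(m)=|\{(a_1,a_2)\in A\times A: m=a_1-a_2\}|$. For natural numbers $g,N$ let $$\eta_g(N)=\min\{|A| : A\subset\mathbb Z \text{ finite and } r_A(m)\ge g \text{ for every integer } 1\le m\le N\}.$$ For a Lebesgue measurable function $f:\mathbb R\to\mathbb R_{\ge 0}$ let $(f\star f)(x)=\int_{\mathbb R} f(t)f(x+t)\,dt\in[0,\infty]$, let $\mathcal F$ be the set of all such $f$ with $(f\star f)(x)\ge 1$ for every $x\in[0,1]$, and let $$\tau=\inf_{f\in\mathcal F}\int_{\mathbb R} f(x)\,dx .$$ Then $\tau<\infty$, both of the following limits as $g\to\infty$ exist, and $$\lim_{g\to\infty}\liminf_{N\to\infty}\frac{\eta_g(N)}{\sqrt{gN}}=\tau=\lim_{g\to\infty}\limsup_{N\to\infty}\frac{\eta_g(N)}{\sqrt{gN}}.$$ -/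

import Mathlib

open MeasureTheory Filter Topology
open scoped NNReal ENNReal

/-- The number of representations `m = a₁ - a₂` with `(a₁, a₂) ∈ A × A`. -/
def diffRep (A : Finset ℤ) (m : ℤ) : ℕ :=
  ((A ×ˢ A).filter (fun p => m = p.1 - p.2)).card

/-- `A` is a `g`-difference set for `[N] = {1, …, N}`: every `m ∈ [N]` has at least `g`
representations as a difference of two elements of `A`. -/
def IsDiffSetFor (g N : ℕ) (A : Finset ℤ) : Prop :=
  ∀ m : ℤ, 1 ≤ m → m ≤ (N : ℤ) → g ≤ diffRep A m

/-- `η_g(N)`, the minimum size of a `g`-difference set for `[N]`. Infinite sets never attain the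
minimum, because a finite `g`-difference set for `[N]` always exists (`exists_isDiffSetFor`). -/
noncomputable def eta (g N : ℕ) : ℕ :=
  sInf {n : ℕ | ∃ A : Finset ℤ, IsDiffSetFor g N A ∧ A.card = n}

theorem exists_isDiffSetFor (g N : ℕ) : ∃ A : Finset ℤ, IsDiffSetFor g N A := by
  refine ⟨Finset.Icc 0 ((N : ℤ) + g), fun m h1 h2 => ?_⟩
  have hsub : (Finset.range g).image (fun i : ℕ => (m + (i : ℤ), (i : ℤ))) ⊆
      ((Finset.Icc 0 ((N : ℤ) + g) ×ˢ Finset.Icc 0 ((N : ℤ) + g)).filter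
        (fun p => m = p.1 - p.2)) := by
    intro p hp
    simp only [Finset.mem_image, Finset.mem_range] at hp
    obtain ⟨i, hi, rfl⟩ := hp
    simp only [Finset.mem_filter, Finset.mem_product, Finset.mem_Icc]
    omega
  have hcard := Finset.card_le_card hsub
  rwa [Finset.card_image_of_injective _ (fun i j h => by simpa using h),
    Finset.card_range] at hcard

/-- The infimum defining `eta` is a minimum. -/
theorem eta_isLeast (g N : ℕ) :
    IsLeast {n : ℕ | ∃ A : Finset ℤ, IsDiffSetFor g N A ∧ A.card = n} (eta g N) := by
  obtain ⟨A, hA⟩ := exists_isDiffSetFor g N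
  exact ⟨Nat.sInf_mem ⟨A.card, A, hA, rfl⟩, fun n hn => Nat.sInf_le hn⟩

/-- The autocorrelation integral `(f ⋆ f)(x) = ∫ f(t) f(x + t) dt` of a nonnegative function,
with values in `[0, ∞]`. -/
noncomputable def autocorr (f : ℝ → ℝ≥0) (x : ℝ) : ℝ≥0∞ :=
  ∫⁻ t : ℝ, (f t : ℝ≥0∞) * (f (x + t) : ℝ≥0∞)

/-- The family of (Lebesgue measurable) nonnegative functions on `ℝ` whose autocorrelation integral
is at least `1` at every point of `[0, 1]`. -/
def autocorrFamily : Set (ℝ → ℝ≥0) :=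
  {f | AEMeasurable f volume ∧ ∀ x ∈ Set.Icc (0 : ℝ) 1, 1 ≤ autocorr f x}

/-- `τ`, the infimum of `∫ f` over the family. -/
noncomputable def tau : ℝ≥0∞ :=
  ⨅ f ∈ autocorrFamily, ∫⁻ x : ℝ, (f x : ℝ≥0∞)

/-- The ratio `η_g(N) / √(gN)`, regarded as an element of `[0, ∞]`, where every `liminf` and
`limsup` exists. -/
noncomputable def etaRatio (g N : ℕ) : ℝ≥0∞ :=
  ENNReal.ofReal ((eta g N : ℝ) / Real.sqrt ((g : ℝ) * (N : ℝ)))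

/-! The lower bound `tau_le_etaRatio` holds for all positive `g` and `N`: spread a difference set
over cells of length `1/N` and rescale; the resulting step function lies in `autocorrFamily`. For
the upper bound, discretise a nearly optimal `f` into nonnegative integer weights on `ℤ` whose
correlations at all lags `0, …, K` are at least `g` (`exists_weights_of_tau_lt`). Then cut `ℤ` into
blocks of length `p(p-1)` and put into each block as many Ruzsa sets modulo `p(p-1)` as its weight
prescribes. Two Ruzsa sets with different parameters represent almost every residue as a difference,
so representations of `m` are counted by the correlation of the weights at lag `⌊m/(p(p-1))⌋`. The
exceptional `m` are covered by an extra set of at most `p` elements (`exists_eta_mul_le`). The total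
weight is about `τ√(gK)` and each set has about `p` elements per block, which gives `τ√(gN)` for `N
= p(p-1)K`; `eventually_etaRatio_le` passes to all large `N`. -/

/-! ### Representation counts and a crude difference set. -/

theorem card_le_diffRep {ι : Type*} {T : Finset ι} {A : Finset ℤ} {m : ℤ} (h : ι → ℤ)
    (hinj : Set.InjOn h T) (hA : ∀ t ∈ T, h t ∈ A ∧ h t + m ∈ A) : T.card ≤ diffRep A m := by
  refine Finset.card_le_card_of_injOn (fun t => (h t + m, h t)) (fun t ht => ?_) ?_
  · simp [hA t ht]
  · intro t ht t' ht' e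
    exact hinj ht ht' (Prod.ext_iff.1 e).2

theorem diffRep_mono {A B : Finset ℤ} (h : A ⊆ B) (m : ℤ) : diffRep A m ≤ diffRep B m :=
  Finset.card_le_card (Finset.filter_subset_filter _ (Finset.product_subset_product h h))

theorem diffRep_le_diffRep {D E : Finset ℤ} {n m : ℤ} (φ ψ : ℤ → ℤ) (hψ : ψ.Injective)
    (hφE : ∀ d ∈ D, φ d ∈ E) (hψE : ∀ d ∈ D, ψ d ∈ E) (h : ∀ d, ψ d + m = φ (d + n)) :
    diffRep D n ≤ diffRep E m := by
  refine card_le_diffRep (fun q => ψ q.2) ?_ ?_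
  · rintro ⟨a, b⟩ hq ⟨a', b'⟩ hq' e
    simp only [Finset.coe_filter, Set.mem_ofPred_eq] at hq hq'
    have : b = b' := hψ e
    grind
  · rintro ⟨a, b⟩ hq
    simp only [Finset.mem_filter, Finset.mem_product] at hq
    refine ⟨hψE _ hq.1.2, ?_⟩
    have : b + n = a := by lia
    simp only [h, this]
    exact hφE _ hq.1.1

/-- A `g`-difference set for `{0, …, L ^ 2}` of size `O_g(L)`. -/
theorem exists_diffRep_le_sq (g L : ℕ) (hL : 0 < L) : ∃ D : Finset ℤ,
    D.card ≤ g * L + (L + g + 1) ∧ ∀ n : ℤ, 0 ≤ n → n ≤ (L : ℤ) ^ 2 → g ≤ diffRep D n := by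
  refine ⟨Finset.Ico 0 ((g : ℤ) * L) ∪ (Finset.Ico (0 : ℤ) (L + g + 1)).image (fun i => L * i),
    ?_, fun n h0 hn => ?_⟩
  · refine (Finset.card_union_le _ _).trans (add_le_add ?_ (Finset.card_image_le.trans ?_))
    · simp only [Int.card_Ico]; lia
    · simp only [Int.card_Ico]; lia
  · have hL' : (0 : ℤ) < L := by exact_mod_cast hL
    -- With `r = -n mod L`, the number `n + r` is a multiple of `L`. Adding `L * i` to both members
    -- of this pair for `i < g` gives `g` representations of `n`.
    have hr0 := Int.emod_nonneg (-n) hL'.ne'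
    have hr1 := Int.emod_lt_of_pos (-n) hL'
    have hr := Int.emod_add_mul_ediv (-n) L
    set r := (-n) % (L : ℤ)
    set e := (-n) / (L : ℤ)
    have key := card_le_diffRep (T := Finset.range g)
      (A := Finset.Ico 0 ((g : ℤ) * L) ∪ (Finset.Ico (0 : ℤ) (L + g + 1)).image (fun i => L * i))
      (m := n) (fun i => r + L * i) ?_ ?_
    · simpa using key
    · intro i _ j _ hij
      simp only [add_right_inj, mul_eq_mul_left_iff, Nat.cast_inj] at hij
      lia
    · intro i hi
      have hi' : (i : ℤ) + 1 ≤ g := by exact_mod_cast Finset.mem_range.1 hi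
      constructor
      · refine Finset.mem_union_left _ (Finset.mem_Ico.2 ⟨by positivity, ?_⟩)
        nlinarith
      · refine Finset.mem_union_right _ (Finset.mem_image.2 ⟨i - e, ?_, by linarith⟩)
        refine Finset.mem_Ico.2 ⟨?_, ?_⟩
        · have : e ≤ 0 := by nlinarith
          lia
        · have : -e ≤ L := by nlinarith
          lia

/-! ### Ruzsa sets modulo `p(p-1)` and their block composition. -/

section Ruzsa

variable {p : ℕ} [Fact p.Prime] (θ : (ZMod p)ˣ)

/-- The congruence defining (a dilate of) Ruzsa's Sidon set modulo `p (p - 1)`. -/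
def IsRuzsa (j a : ℤ) : Prop := (a : ZMod p) = ((θ ^ (j + a) : (ZMod p)ˣ) : ZMod p)

theorem zpow_unit_eq_one (x : ℤ) : θ ^ (((p : ℤ) - 1) * x) = 1 := by
  have h : θ ^ ((p : ℤ) - 1) = 1 := by
    have := ZMod.units_pow_card_sub_one_eq_one p θ
    rw [← zpow_natCast, Nat.cast_sub (Fact.out : p.Prime).one_le] at this
    simpa using this
  rw [zpow_mul, h, one_zpow]

theorem isRuzsa_add_mul (j a x : ℤ) :
    IsRuzsa θ j (a + (p : ℤ) * ((p : ℤ) - 1) * x) ↔ IsRuzsa θ j a := by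
  have : j + (a + (p : ℤ) * ((p : ℤ) - 1) * x) = (j + a) + ((p : ℤ) - 1) * (p * x) := by ring
  unfold IsRuzsa
  rw [this, zpow_add, zpow_unit_eq_one]
  simp

theorem IsRuzsa.zpow_eq {j j' a : ℤ} (h : IsRuzsa θ j a) (h' : IsRuzsa θ j' a) :
    θ ^ j = θ ^ j' := by
  have := Units.ext (h.symm.trans h')
  rw [zpow_add, zpow_add] at this
  exact mul_right_cancel this

/-- Subtracting the two congruences leaves `m = θ^b (θ^(j+m) - θ^j')`. Since `θ` generates the
units, this can be solved for `b` modulo `p - 1`; the congruence for `j'` then prescribes `b` modulo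
`p`, and the Chinese remainder theorem applies. -/
theorem exists_isRuzsa_pair (hθ : ∀ u, u ∈ Subgroup.zpowers θ) {m j j' : ℤ}
    (hm : (m : ZMod p) ≠ 0) (hj : θ ^ (j + m) ≠ θ ^ j') :
    ∃ b : ℤ, 0 ≤ b ∧ b < (p : ℤ) * ((p : ℤ) - 1) ∧ IsRuzsa θ j' b ∧ IsRuzsa θ j (b + m) := by
  have hp := (Fact.out : p.Prime).two_le
  have hQ : (0 : ℤ) < (p : ℤ) * ((p : ℤ) - 1) := by
    have : (2 : ℤ) ≤ p := by exact_mod_cast hp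
    nlinarith
  have hne : ((θ ^ (j + m) : (ZMod p)ˣ) : ZMod p) - ((θ ^ j' : (ZMod p)ˣ) : ZMod p) ≠ 0 := by
    rw [sub_ne_zero]
    exact fun h => hj (Units.ext h)
  obtain ⟨y, hy⟩ := hθ (Units.mk0 _ hm / Units.mk0 _ hne)
  have hy' : ((θ ^ y : (ZMod p)ˣ) : ZMod p) *
      (((θ ^ (j + m) : (ZMod p)ˣ) : ZMod p) - ((θ ^ j' : (ZMod p)ˣ) : ZMod p)) = m := by
    have := congrArg (Units.val) (eq_div_iff_mul_eq'.1 hy)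
    simpa using this
  obtain ⟨t, ht⟩ := ZMod.intCast_surjective ((θ ^ (j' + y) : (ZMod p)ˣ) : ZMod p)
  -- Explicit Chinese remainder solution: `b₀ ≡ y` modulo `p - 1` and `b₀ ≡ t` modulo `p`.
  set b₀ : ℤ := p * y - (p - 1) * t with hb₀
  have hb₀' : b₀ = y + (p - 1) * (y - t) := by rw [hb₀]; ring
  have hpow : θ ^ b₀ = θ ^ y := by rw [hb₀', zpow_add, zpow_unit_eq_one, mul_one]
  have hcast : (b₀ : ZMod p) = t := by rw [hb₀]; push_cast; simp
  have h1 : IsRuzsa θ j' b₀ := by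
    unfold IsRuzsa
    rw [hcast, ht, zpow_add, zpow_add, hpow]
  have h2 : IsRuzsa θ j (b₀ + m) := by
    unfold IsRuzsa at h1 ⊢
    have e : j + (b₀ + m) = (j + m) + b₀ := by ring
    rw [Int.cast_add, h1, ← hy', e, zpow_add θ j' b₀, zpow_add θ (j + m) b₀, hpow]
    push_cast
    ring
  have hdiv := Int.emod_add_mul_ediv b₀ ((p : ℤ) * ((p : ℤ) - 1))
  refine ⟨b₀ % ((p : ℤ) * ((p : ℤ) - 1)), Int.emod_nonneg _ hQ.ne', Int.emod_lt_of_pos _ hQ, ?_, ?_⟩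
  · rwa [← isRuzsa_add_mul θ _ _ (b₀ / ((p : ℤ) * ((p : ℤ) - 1))), hdiv]
  · rwa [← isRuzsa_add_mul θ _ _ (b₀ / ((p : ℤ) * ((p : ℤ) - 1))), add_right_comm, hdiv]

open Classical in
/-- The solutions of the Ruzsa congruence in the `s`-th block of length `p (p - 1)`. -/
noncomputable def ruzsaBlock (j s : ℤ) : Finset ℤ :=
  (Finset.Ico ((p : ℤ) * ((p : ℤ) - 1) * s) ((p : ℤ) * ((p : ℤ) - 1) * (s + 1))).filter
    (IsRuzsa θ j)

/-- The residue modulo `p - 1` determines `θ^(j+a)`, hence `a` modulo `p`, hence `a` inside its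
block. -/
theorem card_ruzsaBlock_le (j s : ℤ) : (ruzsaBlock θ j s).card ≤ p - 1 := by
  have hp := (Fact.out : p.Prime).two_le
  have hp2 : (2 : ℤ) ≤ p := by exact_mod_cast hp
  have hp1 : (0 : ℤ) < (p : ℤ) - 1 := by linarith
  have : (Finset.Ico (0 : ℤ) ((p : ℤ) - 1)).card = p - 1 := by
    rw [Int.card_Ico]; lia
  rw [← this]
  refine Finset.card_le_card_of_injOn (fun a => a % ((p : ℤ) - 1)) (fun a _ => ?_) ?_
  · simpa using ⟨Int.emod_nonneg _ hp1.ne', Int.emod_lt_of_pos _ hp1⟩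
  · intro a ha b hb hab
    simp only [ruzsaBlock, Finset.coe_filter, Finset.mem_Ico, Set.mem_ofPred_eq] at ha hb
    have h1 : ((p : ℤ) - 1) ∣ b - a := Int.ModEq.dvd hab
    have h2 : (p : ℤ) ∣ b - a := by
      obtain ⟨c, hc⟩ := h1
      have hab' : b = a + ((p : ℤ) - 1) * c := by linarith
      have hpow : θ ^ (j + b) = θ ^ (j + a) := by
        rw [hab', ← add_assoc, zpow_add, zpow_unit_eq_one, mul_one]
      have e : (a : ZMod p) = (b : ZMod p) := by
        rw [show (a : ZMod p) = _ from ha.2, show (b : ZMod p) = _ from hb.2, hpow]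
      exact ((ZMod.intCast_eq_intCast_iff a b p).1 e).dvd
    have hco : IsCoprime (p : ℤ) ((p : ℤ) - 1) := ⟨1, -1, by ring⟩
    obtain ⟨c, hc⟩ := hco.mul_dvd h2 h1
    have hQ : (0 : ℤ) < (p : ℤ) * ((p : ℤ) - 1) := by positivity
    have hc0 : c = 0 := by
      have : c < 1 := by nlinarith
      have : -1 < c := by nlinarith
      lia
    rw [hc0] at hc
    lia

/-- Block `s` of `A` holds the Ruzsa sets with parameters `j < μ s`. Each `s` and each pair of
parameters below `ν s` and `ν (s + k)` contributes its own representation of `m`. By `hV` these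
parameters are distinct exponents below the order of `θ`, so the smaller member of the pair recovers
`s` and both parameters. -/
theorem exists_ruzsa_composite (hθ : ∀ u, u ∈ Subgroup.zpowers θ) (S : Finset ℤ) (ν μ : ℤ → ℕ)
    (h0 : ∀ s, ν s ≤ μ s) (h1 : ∀ s, ν s ≤ μ (s + 1)) (hS : ∀ s, μ s ≠ 0 → s ∈ S)
    (hV : ∀ s, ν s ≤ p - 1) :
    ∃ A : Finset ℤ, A.card ≤ (p - 1) * ∑ s ∈ S, μ s ∧
      ∀ m k : ℤ, m / ((p : ℤ) * ((p : ℤ) - 1)) = k → (m : ZMod p) ≠ 0 →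
        (∀ s s' : ℤ, ∀ j < ν s, ∀ j' < ν s', θ ^ ((j : ℤ) + m) ≠ θ ^ (j' : ℤ)) →
        ∑ s ∈ S, ν s * ν (s + k) ≤ diffRep A m := by
  have hp := (Fact.out : p.Prime).two_le
  have hp2 : (2 : ℤ) ≤ p := by exact_mod_cast hp
  have hQ : (0 : ℤ) < (p : ℤ) * ((p : ℤ) - 1) := by nlinarith
  have hord : orderOf θ = p - 1 := by
    rw [orderOf_eq_card_of_forall_mem_zpowers hθ, Nat.card_eq_fintype_card, ZMod.card_units]
  have hinj : ∀ j j' : ℕ, j < p - 1 → j' < p - 1 → θ ^ (j : ℤ) = θ ^ (j' : ℤ) → j = j' := by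
    intro j j' hj hj' h
    rw [zpow_natCast, zpow_natCast] at h
    exact pow_injOn_Iio_orderOf (by simpa [hord] using hj) (by simpa [hord] using hj') h
  set A : Finset ℤ := S.biUnion fun s => (Finset.range (μ s)).biUnion fun j => ruzsaBlock θ j s
    with hA
  have memA : ∀ (a s : ℤ) (j : ℕ), (p : ℤ) * ((p : ℤ) - 1) * s ≤ a →
      a < (p : ℤ) * ((p : ℤ) - 1) * (s + 1) → j < μ s → IsRuzsa θ j a → a ∈ A := by
    intro a s j ha ha' hj hr
    rw [hA, Finset.mem_biUnion]
    refine ⟨s, hS s (by lia), Finset.mem_biUnion.2 ⟨j, Finset.mem_range.2 hj, ?_⟩⟩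
    simp [ruzsaBlock, ha, ha', hr]
  refine ⟨A, ?_, fun m k hk hm hgood => ?_⟩
  · rw [Finset.mul_sum]
    refine Finset.card_biUnion_le.trans (Finset.sum_le_sum fun s _ => ?_)
    refine Finset.card_biUnion_le.trans ?_
    calc _ ≤ ∑ j ∈ Finset.range (μ s), (p - 1) :=
          Finset.sum_le_sum fun j _ => card_ruzsaBlock_le θ j s
      _ = _ := by simp [mul_comm]
  · have hex : ∀ t : (_ : ℤ) × (ℕ × ℕ), ∃ b : ℤ,
        t.2.1 < ν t.1 → t.2.2 < ν (t.1 + k) →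
        0 ≤ b ∧ b < (p : ℤ) * ((p : ℤ) - 1) ∧ IsRuzsa θ t.2.1 b ∧ IsRuzsa θ t.2.2 (b + m) := by
      rintro ⟨s, j', j⟩
      by_cases h : j' < ν s ∧ j < ν (s + k)
      · obtain ⟨b, hb⟩ := exists_isRuzsa_pair θ hθ hm (hgood _ _ j h.2 j' h.1)
        exact ⟨b, fun _ _ => hb⟩
      · exact ⟨0, fun h' h'' => absurd ⟨h', h''⟩ h⟩
    choose b hb using hex
    have hcard : ∑ s ∈ S, ν s * ν (s + k) =
        (S.sigma fun s => Finset.range (ν s) ×ˢ Finset.range (ν (s + k))).card := by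
      simp
    rw [hcard]
    refine card_le_diffRep (fun t => b t + (p : ℤ) * ((p : ℤ) - 1) * t.1) ?_ ?_
    · rintro t ht t' ht' htt
      simp only [Finset.coe_sigma, Finset.coe_product, Finset.coe_range, Set.mem_sigma_iff,
        Finset.mem_coe, Set.mem_prod, Set.mem_Iio] at ht ht'
      obtain ⟨b0, b1, b2, b3⟩ := hb t ht.2.1 ht.2.2
      obtain ⟨b0', b1', b2', b3'⟩ := hb t' ht'.2.1 ht'.2.2
      have htt : b t + (p : ℤ) * ((p : ℤ) - 1) * t.1 = b t' + (p : ℤ) * ((p : ℤ) - 1) * t'.1 := htt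
      have hs : t.1 = t'.1 := by
        have h1 : t.1 - t'.1 < 1 := by nlinarith
        have h2 : -1 < t.1 - t'.1 := by nlinarith
        lia
      have hbb : b t = b t' := by rw [hs] at htt; linarith
      rw [← hbb] at b2' b3'
      have e1 := hinj _ _ (ht.2.1.trans_le (hV _)) (ht'.2.1.trans_le (hV _)) (b2.zpow_eq θ b2')
      have e2 := hinj _ _ (ht.2.2.trans_le (hV _)) (ht'.2.2.trans_le (hV _)) (b3.zpow_eq θ b3')
      obtain ⟨s, j', j⟩ := t
      obtain ⟨s', i', i⟩ := t'
      simp only at hs e1 e2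
      subst hs e1 e2
      rfl
    · rintro t ht
      simp only [Finset.mem_sigma, Finset.mem_product, Finset.mem_range] at ht
      obtain ⟨b0, b1, b2, b3⟩ := hb t ht.2.1 ht.2.2
      refine ⟨memA _ t.1 t.2.1 (by linarith) (by linarith) (ht.2.1.trans_le (h0 _))
        ((isRuzsa_add_mul θ _ _ _).2 b2), ?_⟩
      have hr0 := Int.emod_nonneg m hQ.ne'
      have hr1 := Int.emod_lt_of_pos m hQ
      have hr := Int.emod_add_mul_ediv m ((p : ℤ) * ((p : ℤ) - 1))
      rw [hk] at hr
      have hR : IsRuzsa θ t.2.2 (b t + (p : ℤ) * ((p : ℤ) - 1) * t.1 + m) := by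
        rw [add_right_comm]
        exact (isRuzsa_add_mul θ _ _ _).2 b3
      -- Adding `m` moves block `s` to block `s + k`, or to `s + k + 1` after a carry; `h0` serves
      -- the first case and `h1` the second.
      by_cases hlt : b t + m % ((p : ℤ) * ((p : ℤ) - 1)) < (p : ℤ) * ((p : ℤ) - 1)
      · exact memA _ (t.1 + k) t.2.2 (by linarith) (by linarith) (ht.2.2.trans_le (h0 _)) hR
      · exact memA _ (t.1 + k + 1) t.2.2 (by linarith) (by linarith) (ht.2.2.trans_le (h1 _)) hR

end Ruzsa

/-! ### Bounding `eta` at `p(p-1)K` by the total weight. -/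

theorem eta_le_card {g N : ℕ} {A : Finset ℤ} (h : IsDiffSetFor g N A) : eta g N ≤ A.card :=
  (eta_isLeast g N).2 ⟨A, h, rfl⟩

theorem eta_mono_right (g : ℕ) {M N : ℕ} (h : M ≤ N) : eta g M ≤ eta g N := by
  obtain ⟨A, hA, hc⟩ := (eta_isLeast g N).1
  rw [← hc]
  exact eta_le_card fun m h1 h2 => hA m h1 (h2.trans (by exact_mod_cast h))

/-- A small set representing all multiples of `p` and all integers close to multiples of `p - 1`. -/
theorem exists_small_diffRep (g K V : ℕ) : ∃ p₀ : ℕ, ∀ p ≥ p₀, ∃ E : Finset ℤ, E.card ≤ p ∧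
    (∀ n : ℤ, 0 ≤ n → n ≤ p * K → g ≤ diffRep E (p * n)) ∧
    ∀ n : ℤ, 0 ≤ n → n ≤ p * K + V → ∀ i < V, ∀ j < V,
      g ≤ diffRep E (((p : ℤ) - 1) * n + ((i : ℤ) - j)) := by
  -- The crude set `D` has at most `(2g + 2)L` elements and is used `1 + V` times, so `L = p / C`
  -- keeps `E` within `p` elements, while `L ^ 2` still exceeds `p * K + V` for large `p`.
  set C := (g + 1 + g + 1) * (1 + V) with hC
  have hC0 : 0 < C := by positivity
  refine ⟨C * (2 * C * K + V + 1) + 2, fun p hp => ?_⟩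
  set L := p / C with hL
  have hL1 : C * L ≤ p := Nat.mul_div_le p C
  have hL2 : p < C * (L + 1) := Nat.lt_mul_div_succ p hC0
  have hL3 : 2 * C * K + V + 1 ≤ L := by
    rw [hL, Nat.le_div_iff_mul_le hC0]; lia
  have hL4 : p * K + V ≤ L ^ 2 := by
    have : p * K ≤ C * (L + 1) * K := Nat.mul_le_mul_right _ hL2.le
    have : C * (L + 1) * K ≤ C * (2 * L) * K := by gcongr; lia
    have : V ≤ V * L := Nat.le_mul_of_pos_right _ (by lia)
    have : L * (2 * C * K + V) ≤ L * L := Nat.mul_le_mul_left _ (by lia)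
    nlinarith
  obtain ⟨D, hD, hD'⟩ := exists_diffRep_le_sq g L (by lia)
  have hL4' : (p : ℤ) * K + V ≤ (L : ℤ) ^ 2 := by exact_mod_cast hL4
  have hp0 : (p : ℤ) ≠ 0 := by lia
  have hp1 : (p : ℤ) - 1 ≠ 0 := by lia
  refine ⟨D.image (fun d => p * d) ∪
    (D ×ˢ Finset.range V).image (fun q => ((p : ℤ) - 1) * q.1 + q.2), ?_, ?_, ?_⟩
  · calc _ ≤ D.card + D.card * V := by
          refine (Finset.card_union_le _ _).trans (add_le_add Finset.card_image_le ?_)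
          refine Finset.card_image_le.trans ?_
          simp
      _ = D.card * (1 + V) := by ring
      _ ≤ ((g + 1 + g + 1) * L) * (1 + V) := by
          gcongr
          have : g ≤ g * L := Nat.le_mul_of_pos_right _ (by lia)
          nlinarith
      _ = C * L := by rw [hC]; ring
      _ ≤ p := hL1
  · intro n h0 h1
    refine (hD' n h0 (by lia)).trans (diffRep_le_diffRep (fun d => p * d) (fun d => p * d)
      (mul_right_injective₀ hp0) ?_ ?_ fun d => by ring)
    all_goals exact fun d hd => Finset.mem_union_left _ (Finset.mem_image_of_mem _ hd)
  · intro n h0 h1 i hi j hj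
    refine (hD' n h0 (by lia)).trans (diffRep_le_diffRep (fun d => ((p : ℤ) - 1) * d + i)
      (fun d => ((p : ℤ) - 1) * d + j) (fun a b hab => ?_) ?_ ?_ fun d => by ring)
    · exact mul_right_injective₀ hp1 (add_right_cancel hab)
    · exact fun d hd => Finset.mem_union_right _ (Finset.mem_image.2 ⟨(d, i), by simp [hd, hi], rfl⟩)
    · exact fun d hd => Finset.mem_union_right _ (Finset.mem_image.2 ⟨(d, j), by simp [hd, hj], rfl⟩)

/-- The Ruzsa composite can fail only if `p ∣ m`, or if `θ^(j+m) = θ^j'` for some parameters, that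
is, `m ≡ j' - j` modulo `p - 1` with `j, j' < V`. These are the integers represented by `E`, which
accounts for the `+ 1` in the bound. -/
theorem exists_eta_mul_le (g K : ℕ) (S : Finset ℤ) (ν μ : ℤ → ℕ)
    (h0 : ∀ s, ν s ≤ μ s) (h1 : ∀ s, ν s ≤ μ (s + 1)) (hS : ∀ s, μ s ≠ 0 → s ∈ S)
    (hg : ∀ k : ℤ, 0 ≤ k → k ≤ K → g ≤ ∑ s ∈ S, ν s * ν (s + k)) :
    ∃ p₀ : ℕ, ∀ p ≥ p₀, p.Prime → eta g (p * (p - 1) * K) ≤ p * (∑ s ∈ S, μ s + 1) := by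
  set V := ∑ s ∈ S, μ s with hV
  have hνV : ∀ s, ν s ≤ V := fun s => by
    by_cases hs : s ∈ S
    · exact (h0 s).trans (Finset.single_le_sum (fun _ _ => Nat.zero_le _) hs)
    · have : μ s = 0 := by_contra fun h => hs (hS s h)
      exact (h0 s).trans (by lia)
  obtain ⟨p₀, hp₀⟩ := exists_small_diffRep g K V
  refine ⟨p₀ + V + 2, fun p hp hprime => ?_⟩
  have : Fact p.Prime := ⟨hprime⟩
  obtain ⟨E, hE, hE1, hE2⟩ := hp₀ p (by lia)
  obtain ⟨θ, hθ⟩ := IsCyclic.exists_generator (α := (ZMod p)ˣ)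
  have hord : orderOf θ = p - 1 := by
    rw [orderOf_eq_card_of_forall_mem_zpowers hθ, Nat.card_eq_fintype_card, ZMod.card_units]
  obtain ⟨A, hA, hA'⟩ := exists_ruzsa_composite θ hθ S ν μ h0 h1 hS
    (fun s => (hνV s).trans (by lia))
  have hp2 : (2 : ℤ) ≤ p := by exact_mod_cast hprime.two_le
  have hpV : (V : ℤ) + 2 ≤ p := by lia
  have hQ : (0 : ℤ) < (p : ℤ) * ((p : ℤ) - 1) := by nlinarith
  refine (eta_le_card (A := A ∪ E) fun m hm1 hm2 => ?_).trans ?_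
  · have hm2 : m ≤ (p : ℤ) * ((p : ℤ) - 1) * K := by
      have : (((p * (p - 1) * K : ℕ)) : ℤ) = (p : ℤ) * ((p : ℤ) - 1) * K := by
        push_cast [Nat.cast_sub hprime.one_le]; ring
      rwa [this] at hm2
    by_cases hmp : (m : ZMod p) = 0
    · obtain ⟨n, rfl⟩ := (ZMod.intCast_zmod_eq_zero_iff_dvd m p).1 hmp
      refine (hE1 n (by nlinarith) ?_).trans (diffRep_mono Finset.subset_union_right _)
      have : n ≤ ((p : ℤ) - 1) * K := by
        refine le_of_mul_le_mul_left (a := (p : ℤ)) ?_ (by linarith)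
        linarith
      nlinarith
    by_cases hgood : ∀ s s' : ℤ, ∀ j < ν s, ∀ j' < ν s', θ ^ ((j : ℤ) + m) ≠ θ ^ (j' : ℤ)
    · refine ((hg (m / ((p : ℤ) * ((p : ℤ) - 1))) (Int.ediv_nonneg (by lia) hQ.le) ?_).trans
        (hA' m _ rfl hmp hgood)).trans (diffRep_mono Finset.subset_union_left _)
      exact Int.ediv_le_of_le_mul hQ (by linarith)
    · push Not at hgood
      obtain ⟨s, s', j, hj, j', hj', e⟩ := hgood
      have hd : ((p : ℤ) - 1) ∣ (j : ℤ) + m - j' := by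
        have : θ ^ ((j : ℤ) + m - j') = 1 := by rw [zpow_sub, e, mul_inv_cancel]
        have := orderOf_dvd_iff_zpow_eq_one.2 this
        rwa [hord, Nat.cast_sub hprime.one_le, Nat.cast_one] at this
      obtain ⟨n, hn⟩ := hd
      have hmn : m = ((p : ℤ) - 1) * n + ((j' : ℤ) - j) := by linarith
      have hjV := hj.trans_le (hνV s)
      have hjV' := hj'.trans_le (hνV s')
      rw [hmn]
      refine (hE2 n ?_ ?_ j' hjV' j hjV).trans (diffRep_mono Finset.subset_union_right _)
      · by_contra hneg
        have : n ≤ -1 := by lia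
        nlinarith
      · by_contra hneg
        have : (p : ℤ) * K + V + 1 ≤ n := by lia
        have hjz : (j : ℤ) < V := by exact_mod_cast hjV
        nlinarith
  · calc _ ≤ A.card + E.card := Finset.card_union_le _ _
      _ ≤ p * V + p := add_le_add (hA.trans (Nat.mul_le_mul_right _ (by lia))) hE
      _ = _ := by ring

/-! ### The lower bound: step functions from difference sets. -/

theorem measurableSet_floor_mul_mem (κ : ℝ) (A : Set ℤ) :
    MeasurableSet {t : ℝ | ⌊κ * t⌋ ∈ A} :=
  (Int.measurable_floor.comp (measurable_const_mul κ)) (MeasurableSet.of_discrete (s := A))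

theorem measurable_ite_floor_mul (κ : ℝ) (a : ℤ) :
    Measurable fun t : ℝ => if ⌊κ * t⌋ = a then (1 : ℝ≥0∞) else 0 :=
  Measurable.ite (measurableSet_floor_mul_mem κ {a}) measurable_const measurable_const

theorem lintegral_ite_floor_mul {κ : ℝ} (hκ : 0 < κ) (a : ℤ) :
    ∫⁻ t : ℝ, (if ⌊κ * t⌋ = a then (1 : ℝ≥0∞) else 0) = ENNReal.ofReal (1 / κ) := by
  have h : (fun t : ℝ => if ⌊κ * t⌋ = a then (1 : ℝ≥0∞) else 0) =
      (Set.Ico (a / κ) ((a + 1) / κ)).indicator 1 := by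
    funext t
    rw [Set.indicator_apply]
    congr 1
    rw [Int.floor_eq_iff, Set.mem_Ico, div_le_iff₀ hκ, lt_div_iff₀ hκ, mul_comm]
  rw [h, lintegral_indicator_one measurableSet_Ico, Real.volume_Ico]
  congr 1
  ring

/-- The integral of a function supported on the cells `⌊κ t⌋ ∈ A` folds to the cell of `0`. -/
theorem lintegral_eq_sum_translates {κ : ℝ} (hκ : 0 < κ) (A : Finset ℤ) (F : ℝ → ℝ≥0∞)
    (hF : Measurable F) (hA : ∀ t, ⌊κ * t⌋ ∉ A → F t = 0) :
    ∫⁻ t, F t = ∫⁻ t, (if ⌊κ * t⌋ = 0 then 1 else 0) * ∑ a ∈ A, F (a / κ + t) := by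
  have h1 : ∀ t, F t = ∑ a ∈ A, (if ⌊κ * t⌋ = a then 1 else 0) * F t := by
    intro t
    by_cases h : ⌊κ * t⌋ ∈ A
    · simp [h]
    · simp [hA t h]
  have hm : ∀ a, Measurable fun t : ℝ => (if ⌊κ * t⌋ = a then (1 : ℝ≥0∞) else 0) * F t :=
    fun a => (measurable_ite_floor_mul κ a).mul hF
  calc _ = ∫⁻ t, ∑ a ∈ A, (if ⌊κ * t⌋ = a then 1 else 0) * F t := lintegral_congr h1
    _ = ∑ a ∈ A, ∫⁻ t, (if ⌊κ * t⌋ = a then 1 else 0) * F t :=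
        lintegral_finsetSum _ fun a _ => hm a
    _ = ∑ a ∈ A, ∫⁻ t, (if ⌊κ * t⌋ = 0 then 1 else 0) * F (a / κ + t) := by
        refine Finset.sum_congr rfl fun a _ => ?_
        rw [← lintegral_add_left_eq_self _ ((a : ℝ) / κ)]
        refine lintegral_congr fun t => ?_
        have : κ * (a / κ + t) = a + κ * t := by field_simp
        rw [this, Int.floor_intCast_add]
        simp
    _ = _ := by
        rw [← lintegral_finsetSum]
        · simp_rw [Finset.mul_sum]
        · intro a _
          exact (measurable_ite_floor_mul κ 0).mul (hF.comp (measurable_const_add _))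

theorem diffRep_eq_card (A : Finset ℤ) (m : ℤ) :
    diffRep A m = (A.filter fun a => a + m ∈ A).card := by
  refine le_antisymm ?_ (card_le_diffRep id Function.injective_id.injOn fun t ht => by
    simpa using ht)
  refine Finset.card_le_card_of_injOn Prod.snd (fun q hq => ?_) fun q hq q' hq' e => ?_
  · simp only [Finset.coe_filter, Finset.mem_product, Set.mem_ofPred_eq] at hq ⊢
    have : q.2 + m = q.1 := by lia
    exact ⟨hq.1.2, this ▸ hq.1.1⟩
  · simp only [Finset.coe_filter, Finset.mem_product, Set.mem_ofPred_eq] at hq hq'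
    refine Prod.ext ?_ e
    lia

/-- Give the cells `[a/N, (a+1)/N)`, `a ∈ A`, the height `c = √(N/g)`. After folding onto the cell
of `0`, the autocorrelation integrand is `c²` times a representation count, hence at least `c² g =
N` on a cell of length `1/N`. The integral is `|A| c / N = |A| / √(gN)`. -/
theorem tau_le_etaRatio {g N : ℕ} (hg : 0 < g) (hN : 0 < N) : tau ≤ etaRatio g N := by
  obtain ⟨A, hA, hcard⟩ := (eta_isLeast g N).1
  have hN' : (0 : ℝ) < N := by exact_mod_cast hN
  have hg' : (0 : ℝ) < g := by exact_mod_cast hg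
  have hrep : ∀ b : ℤ, 0 ≤ b → b ≤ N → g ≤ (A.filter fun a => a + b ∈ A).card := by
    intro b hb hbN
    -- Lag `0` is not covered by `IsDiffSetFor`; it has `|A|` representations, at least as many as
    -- lag `1`.
    rcases hb.eq_or_lt with rfl | hb
    · have h1 := hA 1 le_rfl (by lia)
      rw [diffRep_eq_card] at h1
      refine h1.trans (Finset.card_le_card fun a ha => ?_)
      simp only [Finset.mem_filter] at ha
      simpa using ha.1
    · have := hA b (by lia) hbN
      rwa [diffRep_eq_card] at this
  set c : ℝ≥0 := NNReal.sqrt ((N : ℝ≥0) / g) with hc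
  have hcc : (c : ℝ≥0∞) * c * g = N := by
    have : c * c * g = N := by
      rw [hc, NNReal.mul_self_sqrt]
      have : (g : ℝ≥0) ≠ 0 := by exact_mod_cast hg.ne'
      field_simp
    exact_mod_cast congrArg ((↑) : ℝ≥0 → ℝ≥0∞) this
  have hinv : (N : ℝ≥0∞) * ENNReal.ofReal (1 / (N : ℝ)) = 1 := by
    rw [← ENNReal.ofReal_natCast, ← ENNReal.ofReal_mul hN'.le]
    simp [hN'.ne']
  set f : ℝ → ℝ≥0 := fun t => if ⌊(N : ℝ) * t⌋ ∈ A then c else 0 with hf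
  have hfm : Measurable f :=
    Measurable.ite (measurableSet_floor_mul_mem N (A : Set ℤ)) measurable_const measurable_const
  have hmem : f ∈ autocorrFamily := by
    refine ⟨hfm.aemeasurable, fun x hx => ?_⟩
    unfold autocorr
    rw [lintegral_eq_sum_translates hN' A]
    · have hone : (1 : ℝ≥0∞) =
          ∫⁻ t : ℝ, (N : ℝ≥0∞) * if ⌊(N : ℝ) * t⌋ = 0 then (1 : ℝ≥0∞) else 0 := by
        rw [lintegral_const_mul _ (measurable_ite_floor_mul _ _), lintegral_ite_floor_mul hN',
          hinv]
      refine hone.trans_le (lintegral_mono fun t => ?_)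
      simp only
      split_ifs with ht
      · rw [mul_one, one_mul]
        rw [Int.floor_eq_iff] at ht
        norm_num at ht
        -- Translation by `x` moves every cell `a` to `a + b` with the same `b`, because all folded
        -- points share the offset `t`.
        set b := ⌊(N : ℝ) * (x + t)⌋ with hb
        have hb0 : 0 ≤ b := Int.floor_nonneg.2 (by nlinarith [hx.1])
        have hbN : b ≤ N := by
          have : b < (N : ℤ) + 1 := by
            rw [hb, Int.floor_lt]; push_cast; nlinarith [hx.2]
          lia
        have hval : ∀ a ∈ A, (f ((a : ℝ) / N + t) : ℝ≥0∞) * f (x + ((a : ℝ) / N + t)) =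
            if a + b ∈ A then (c : ℝ≥0∞) * c else 0 := by
          intro a ha
          have e1 : ⌊(N : ℝ) * (a / N + t)⌋ = a := by
            rw [show (N : ℝ) * (a / N + t) = a + N * t by field_simp, Int.floor_intCast_add]
            have : ⌊(N : ℝ) * t⌋ = 0 := Int.floor_eq_iff.2 (by norm_num; exact ht)
            lia
          have e2 : ⌊(N : ℝ) * (x + (a / N + t))⌋ = a + b := by
            rw [show (N : ℝ) * (x + (a / N + t)) = a + N * (x + t) by field_simp; ring,
              Int.floor_intCast_add]
          simp only [hf, e1, e2, ha, if_true]
          split_ifs <;> simp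
        rw [Finset.sum_congr rfl hval, ← Finset.sum_filter, Finset.sum_const, nsmul_eq_mul,
          ← hcc, mul_comm]
        gcongr
        exact hrep b hb0 hbN
      · simp
    · exact hfm.coe_nnreal_ennreal.mul (hfm.comp (measurable_const_add x)).coe_nnreal_ennreal
    · intro t ht
      simp [hf, ht]
  refine (iInf₂_le f hmem).trans ?_
  rw [lintegral_eq_sum_translates hN' A _ hfm.coe_nnreal_ennreal fun t ht => by simp [hf, ht]]
  have hle : ∀ t : ℝ, (if ⌊(N : ℝ) * t⌋ = 0 then 1 else 0) *
      ∑ a ∈ A, (f ((a : ℝ) / N + t) : ℝ≥0∞) ≤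
      (A.card * c : ℝ≥0∞) * (if ⌊(N : ℝ) * t⌋ = 0 then 1 else 0) := by
    intro t
    rw [mul_comm]
    gcongr
    rw [← nsmul_eq_mul]
    refine Finset.sum_le_card_nsmul _ _ _ fun a _ => ?_
    simp only [hf]
    split_ifs <;> simp
  refine (lintegral_mono hle).trans ?_
  rw [lintegral_const_mul _ (measurable_ite_floor_mul _ _), lintegral_ite_floor_mul hN', etaRatio,
    ← hcard, ← ENNReal.ofReal_natCast, ← ENNReal.ofReal_coe_nnreal,
    ← ENNReal.ofReal_mul (Nat.cast_nonneg _), ← ENNReal.ofReal_mul (by positivity)]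
  refine ENNReal.ofReal_le_ofReal (le_of_eq ?_)
  have : (c : ℝ) = Real.sqrt N / Real.sqrt g := by
    rw [hc, Real.coe_sqrt]; push_cast; exact Real.sqrt_div' _ hg'.le
  rw [this, Real.sqrt_mul hg'.le]
  have hs := Real.sqrt_pos.2 hN'
  have hs' := Real.sqrt_pos.2 hg'
  field_simp
  rw [Real.sq_sqrt hN'.le]

/-! ### Finiteness of `tau` and properties of autocorrelations. -/

theorem tau_ne_top : tau ≠ ⊤ := by
  have hmeas : Measurable ((Set.Icc (0 : ℝ) 2).indicator (1 : ℝ → ℝ≥0)) :=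
    measurable_one.indicator measurableSet_Icc
  have hmem : (Set.Icc (0 : ℝ) 2).indicator (1 : ℝ → ℝ≥0) ∈ autocorrFamily := by
    refine ⟨hmeas.aemeasurable, fun x hx => ?_⟩
    have h1 : (1 : ℝ≥0∞) = ∫⁻ t, (Set.Icc (0 : ℝ) 1).indicator 1 t := by
      rw [lintegral_indicator_one measurableSet_Icc]; simp
    rw [h1]
    refine lintegral_mono fun t => ?_
    by_cases ht : t ∈ Set.Icc (0 : ℝ) 1
    · have h2 : t ∈ Set.Icc (0 : ℝ) 2 := ⟨ht.1, by linarith [ht.2]⟩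
      have h3 : x + t ∈ Set.Icc (0 : ℝ) 2 := ⟨by linarith [ht.1, hx.1], by linarith [ht.2, hx.2]⟩
      simp [Set.indicator_of_mem h2, Set.indicator_of_mem h3, Set.indicator_of_mem ht]
    · simp [Set.indicator_of_notMem ht]
  refine ne_top_of_le_ne_top (b := ENNReal.ofReal 2) ENNReal.ofReal_ne_top
    ((iInf₂_le _ hmem).trans (le_of_eq ?_))
  have : (fun x => (((Set.Icc (0 : ℝ) 2).indicator (1 : ℝ → ℝ≥0) x : ℝ≥0) : ℝ≥0∞)) =
      (Set.Icc (0 : ℝ) 2).indicator 1 := by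
    funext x
    by_cases hx : x ∈ Set.Icc (0 : ℝ) 2 <;> simp [Set.indicator, hx]
  rw [this, lintegral_indicator_one measurableSet_Icc]
  simp

theorem autocorr_neg (f : ℝ → ℝ≥0) (x : ℝ) : autocorr f (-x) = autocorr f x := by
  unfold autocorr
  rw [← lintegral_add_left_eq_self _ x]
  refine lintegral_congr fun t => ?_
  rw [neg_add_cancel_left, mul_comm]

/-- Negative arguments are needed because comparing windows of cells involves lags `k - i` of either
sign. -/
theorem one_le_autocorr_of_abs_le {f : ℝ → ℝ≥0} (hf : f ∈ autocorrFamily) {x : ℝ}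
    (hx : |x| ≤ 1) : 1 ≤ autocorr f x := by
  rcases abs_cases x with ⟨h, _⟩ | ⟨h, _⟩
  · exact hf.2 x ⟨by linarith, by linarith⟩
  · rw [← autocorr_neg]
    exact hf.2 (-x) ⟨by linarith, by linarith⟩

theorem autocorr_congr_ae {f f' : ℝ → ℝ≥0} (h : f =ᵐ[volume] f') (x : ℝ) :
    autocorr f x = autocorr f' x := by
  refine lintegral_congr_ae ?_
  filter_upwards [h, (quasiMeasurePreserving_add_left volume x).ae_eq_comp h] with t ht ht'
  simp only [Function.comp_apply] at ht'
  rw [ht, ht']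

theorem exists_measurable_mem_autocorrFamily {f : ℝ → ℝ≥0} (hf : f ∈ autocorrFamily) :
    ∃ f' ∈ autocorrFamily, Measurable f' ∧
      ∫⁻ x, (f' x : ℝ≥0∞) = ∫⁻ x, (f x : ℝ≥0∞) := by
  have hae := hf.1.ae_eq_mk
  refine ⟨hf.1.mk f, ⟨hf.1.measurable_mk.aemeasurable, fun x hx => ?_⟩, hf.1.measurable_mk, ?_⟩
  · rw [← autocorr_congr_ae hae]
    exact hf.2 x hx
  · refine lintegral_congr_ae ?_
    filter_upwards [hae] with x hx
    rw [← hx]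

/-! ### Discretising `f` by cell and window masses. -/

/-- The mass of `f` on the cell `⌊κ x⌋ = s`. -/
noncomputable def cellMass (f : ℝ → ℝ≥0) (κ : ℝ) (s : ℤ) : ℝ≥0∞ :=
  ∫⁻ x, (f x : ℝ≥0∞) * if ⌊κ * x⌋ = s then 1 else 0

/-- The mass of `f` on the `M` consecutive cells starting at `s`. -/
noncomputable def windowMass (f : ℝ → ℝ≥0) (κ : ℝ) (M : ℕ) (s : ℤ) : ℝ≥0∞ :=
  ∑ i ∈ Finset.range M, cellMass f κ (s + i)

theorem measurable_mul_ite_floor {f : ℝ → ℝ≥0} (hf : Measurable f) (κ : ℝ) (s : ℤ) :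
    Measurable fun x => (f x : ℝ≥0∞) * if ⌊κ * x⌋ = s then (1 : ℝ≥0∞) else 0 :=
  hf.coe_nnreal_ennreal.mul (measurable_ite_floor_mul κ s)

theorem tsum_cellMass_mul {f : ℝ → ℝ≥0} (hf : Measurable f) (κ : ℝ) (h : ℤ → ℝ≥0∞) :
    ∑' s, cellMass f κ s * h s = ∫⁻ x, (f x : ℝ≥0∞) * h ⌊κ * x⌋ := by
  have hm := measurable_mul_ite_floor hf κ
  unfold cellMass
  simp_rw [← lintegral_mul_const _ (hm _)]
  rw [← lintegral_tsum fun s => ((hm s).mul_const _).aemeasurable]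
  refine lintegral_congr fun x => ?_
  rw [tsum_eq_single ⌊κ * x⌋]
  · simp
  · intro s hs
    simp [hs.symm]

theorem tsum_windowMass {f : ℝ → ℝ≥0} (hf : Measurable f) (κ : ℝ) (M : ℕ) :
    ∑' s, windowMass f κ M s = M * ∫⁻ x, (f x : ℝ≥0∞) := by
  unfold windowMass
  rw [Summable.tsum_finsetSum fun _ _ => ENNReal.summable]
  have : ∀ i : ℕ, ∑' s, cellMass f κ (s + i) = ∫⁻ x, (f x : ℝ≥0∞) := by
    intro i
    refine ((Equiv.addRight (i : ℤ)).tsum_eq (cellMass f κ)).trans ?_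
    simpa using tsum_cellMass_mul hf κ 1
  simp [this]

/-- The position of `x` inside its cell is unknown, so `M` cells are sure to contain `x + z` only
for `z` in an interval of length `(M - 1) / κ`. The loss of one cell becomes negligible for large
`M`. -/
theorem le_windowMass {f : ℝ → ℝ≥0} (hf : Measurable f) {κ : ℝ} (hκ : 0 < κ) (M : ℕ) (x : ℝ)
    (d : ℤ) : ∫⁻ z, (Set.Icc (d / κ) ((d + M - 1) / κ)).indicator 1 z * (f (x + z) : ℝ≥0∞) ≤
      windowMass f κ M (⌊κ * x⌋ + d) := by
  unfold windowMass cellMass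
  rw [← lintegral_finsetSum _ fun i _ => measurable_mul_ite_floor hf κ _]
  refine le_trans (lintegral_mono fun z => ?_) (lintegral_add_left_eq_self _ x).le
  by_cases hz : z ∈ Set.Icc (d / κ) ((d + M - 1) / κ)
  · rw [Set.indicator_of_mem hz, ← Finset.mul_sum, mul_comm]
    obtain ⟨h1, h2⟩ := hz
    rw [div_le_iff₀ hκ] at h1
    rw [le_div_iff₀ hκ] at h2
    gcongr
    have e1 := Int.floor_le (κ * x)
    have e2 := Int.lt_floor_add_one (κ * x)
    have e3 : ⌊κ * x⌋ + d ≤ ⌊κ * (x + z)⌋ := by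
      rw [Int.le_floor]; push_cast; nlinarith
    have e4 : ⌊κ * (x + z)⌋ < ⌊κ * x⌋ + d + M := by
      rw [Int.floor_lt]; push_cast; nlinarith
    have := Finset.single_le_sum (f := fun i : ℕ =>
      if ⌊κ * (x + z)⌋ = ⌊κ * x⌋ + d + i then (1 : ℝ≥0∞) else 0) (fun _ _ => zero_le)
      (a := (⌊κ * (x + z)⌋ - (⌊κ * x⌋ + d)).toNat) (s := Finset.range M) (by simp; lia)
    refine le_trans (le_of_eq ?_) this
    simp only [Pi.one_apply]
    rw [if_pos (by lia)]
  · rw [Set.indicator_of_notMem hz]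
    simp

/-- Integrate `1 ≤ autocorr f z` over the interval of `le_windowMass` and apply Tonelli; `h1` and
`h2` keep that interval inside `[-1, 1]`. -/
theorem le_tsum_cellMass_mul_windowMass {f : ℝ → ℝ≥0} (hf : Measurable f)
    (hF : f ∈ autocorrFamily) {κ : ℝ} (hκ : 0 < κ) (M : ℕ) (d : ℤ) (h1 : -κ ≤ d)
    (h2 : d + M - 1 ≤ κ) :
    ENNReal.ofReal ((M - 1) / κ) ≤ ∑' s, cellMass f κ s * windowMass f κ M (s + d) := by
  rw [tsum_cellMass_mul hf κ fun s => windowMass f κ M (s + d)]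
  set I := Set.Icc (d / κ) ((d + M - 1) / κ) with hI
  have hIm : Measurable (I.indicator (1 : ℝ → ℝ≥0∞)) := measurable_one.indicator measurableSet_Icc
  calc ENNReal.ofReal ((M - 1) / κ) = ∫⁻ z, I.indicator 1 z := by
        rw [lintegral_indicator_one measurableSet_Icc, Real.volume_Icc]
        congr 1
        ring
    _ ≤ ∫⁻ z, I.indicator 1 z * autocorr f z := by
        refine lintegral_mono fun z => ?_
        by_cases hz : z ∈ I
        · rw [Set.indicator_of_mem hz, Pi.one_apply, one_mul]
          refine one_le_autocorr_of_abs_le hF (abs_le.2 ⟨?_, ?_⟩)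
          · refine le_trans ?_ hz.1
            rw [le_div_iff₀ hκ]; linarith
          · refine hz.2.trans ?_
            rw [div_le_iff₀ hκ]; linarith
        · simp [hz]
    _ = ∫⁻ z, ∫⁻ x, (f x : ℝ≥0∞) * (I.indicator 1 z * f (x + z)) := by
        refine lintegral_congr fun z => ?_
        unfold autocorr
        rw [← lintegral_const_mul]
        · refine lintegral_congr fun x => ?_
          rw [add_comm z x]
          ring
        · exact hf.coe_nnreal_ennreal.mul (hf.comp (measurable_const_add z)).coe_nnreal_ennreal
    _ = ∫⁻ x, ∫⁻ z, (f x : ℝ≥0∞) * (I.indicator 1 z * f (x + z)) := by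
        refine lintegral_lintegral_swap (Measurable.aemeasurable ?_)
        have h1 : Measurable fun q : ℝ × ℝ => (f q.2 : ℝ≥0∞) :=
          (hf.comp measurable_snd).coe_nnreal_ennreal
        have h2 : Measurable fun q : ℝ × ℝ => (f (q.2 + q.1) : ℝ≥0∞) :=
          (hf.comp (measurable_snd.add measurable_fst)).coe_nnreal_ennreal
        exact h1.mul ((hIm.comp measurable_fst).mul h2)
    _ = ∫⁻ x, (f x : ℝ≥0∞) * ∫⁻ z, I.indicator 1 z * (f (x + z) : ℝ≥0∞) := by
        refine lintegral_congr fun x => ?_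
        rw [lintegral_const_mul]
        exact hIm.mul (hf.comp (measurable_const_add x)).coe_nnreal_ennreal
    _ ≤ _ := by
        gcongr with x
        exact le_windowMass hf hκ M x d

/-- Splitting the first window into its `M` cells produces the lags `k - i` with `i < M`; `K + M`
cells per unit length keep all of them admissible. -/
theorem le_tsum_windowMass_mul_windowMass {f : ℝ → ℝ≥0} (hf : Measurable f)
    (hF : f ∈ autocorrFamily) {K M : ℕ} (hM : 0 < M) (k : ℤ) (h0 : 0 ≤ k) (hk : k ≤ K) :
    ENNReal.ofReal (M * (M - 1) / (K + M)) ≤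
      ∑' s, windowMass f (K + M) M s * windowMass f (K + M) M (s + k) := by
  have hκ : (0 : ℝ) < (K : ℝ) + M := by positivity
  have hk0 : (0 : ℝ) ≤ k := by exact_mod_cast h0
  have hkK : (k : ℝ) ≤ K := by exact_mod_cast hk
  have e : ∀ s, windowMass f (K + M) M s * windowMass f (K + M) M (s + k) =
      ∑ i ∈ Finset.range M, cellMass f (K + M) (s + i) * windowMass f (K + M) M (s + k) := by
    intro s
    rw [← Finset.sum_mul]
    rfl
  simp_rw [e]
  rw [Summable.tsum_finsetSum fun _ _ => ENNReal.summable]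
  calc ENNReal.ofReal (M * (M - 1) / (K + M))
      = ∑ i ∈ Finset.range M, ENNReal.ofReal ((M - 1) / (K + M)) := by
        rw [Finset.sum_const, Finset.card_range, nsmul_eq_mul, mul_div_assoc,
          ENNReal.ofReal_mul (Nat.cast_nonneg _), ENNReal.ofReal_natCast]
    _ ≤ _ := by
        refine Finset.sum_le_sum fun i hi => ?_
        have hi : (i : ℝ) + 1 ≤ M := by exact_mod_cast Finset.mem_range.1 hi
        have hi0 : (0 : ℝ) ≤ i := by positivity
        have := le_tsum_cellMass_mul_windowMass hf hF hκ M (k - i)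
          (by push_cast; linarith) (by push_cast; linarith)
        refine this.trans (le_of_eq ?_)
        rw [← (Equiv.addRight (i : ℤ)).tsum_eq]
        refine tsum_congr fun s => ?_
        simp only [Equiv.coe_addRight]
        congr 2
        ring

/-- Together with the next lemma: one window of `M + 1` cells dominates two adjacent windows of `M`
cells. Hence the larger weights `μ` demanded by the carry cost only a factor `(M + 1) / M` in total
mass. -/
theorem windowMass_le_succ (f : ℝ → ℝ≥0) (κ : ℝ) (M : ℕ) (s : ℤ) :
    windowMass f κ M s ≤ windowMass f κ (M + 1) s := by
  unfold windowMass
  rw [Finset.sum_range_succ]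
  exact le_self_add

theorem windowMass_le_succ_sub_one (f : ℝ → ℝ≥0) (κ : ℝ) (M : ℕ) (s : ℤ) :
    windowMass f κ M s ≤ windowMass f κ (M + 1) (s - 1) := by
  unfold windowMass
  rw [Finset.sum_range_succ']
  refine le_trans (le_of_eq (Finset.sum_congr rfl fun i _ => ?_)) le_self_add
  congr 1
  push_cast
  ring

/-! ### Truncation and rounding to integer weights. -/

theorem exists_finset_lt_sum {ι κ : Type*} (J : Finset κ) (F : κ → ι → ℝ≥0∞) (B : ℝ≥0∞)
    (h : ∀ k ∈ J, B < ∑' s, F k s) : ∃ S : Finset ι, ∀ k ∈ J, B < ∑ s ∈ S, F k s := by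
  classical
  have : ∀ k, ∃ S : Finset ι, k ∈ J → B < ∑ s ∈ S, F k s := by
    intro k
    by_cases hk : k ∈ J
    · have := h k hk
      rw [ENNReal.tsum_eq_iSup_sum, lt_iSup_iff] at this
      exact this.imp fun S hS _ => hS
    · exact ⟨∅, fun h' => absurd h' hk⟩
  choose S hS using this
  exact ⟨J.biUnion S, fun k hk => (hS k hk).trans_le
    (Finset.sum_le_sum_of_subset (Finset.subset_biUnion_of_mem S hk))⟩

/-- Rounding real weights `v ≤ w` with large correlations up to integer weights. -/
theorem exists_nat_weights {K : ℕ} {v w : ℤ → ℝ} {B W : ℝ} (hB : 0 < B) (hv : ∀ s, 0 ≤ v s)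
    (hvw : ∀ s, v s ≤ w s) (hvw' : ∀ s, v (s - 1) ≤ w s) (S₀ : Finset ℤ)
    (hS₀ : ∀ k : ℤ, 0 ≤ k → k ≤ K → B ≤ ∑ s ∈ S₀, v s * v (s + k))
    (hW : ∀ S : Finset ℤ, ∑ s ∈ S, w s ≤ W) :
    ∃ S : Finset ℤ, ∀ g : ℕ, ∃ ν μ : ℤ → ℕ, (∀ s, ν s ≤ μ s) ∧ (∀ s, ν s ≤ μ (s + 1)) ∧
      (∀ s, μ s ≠ 0 → s ∈ S) ∧
      (∀ k : ℤ, 0 ≤ k → k ≤ K → g ≤ ∑ s ∈ S, ν s * ν (s + k)) ∧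
      ((∑ s ∈ S, μ s : ℕ) : ℝ) ≤ √(g / B) * W + S.card := by
  set S₁ : Finset ℤ := (Finset.Icc (0 : ℤ) K).biUnion fun k => S₀.image (· + k) with hS₁
  have hmem : ∀ s ∈ S₀, ∀ k : ℤ, 0 ≤ k → k ≤ K → s + k ∈ S₁ := fun s hs k h0 hk =>
    Finset.mem_biUnion.2 ⟨k, Finset.mem_Icc.2 ⟨h0, hk⟩, Finset.mem_image_of_mem _ hs⟩
  have hsub : S₀ ⊆ S₁ := fun s hs => by simpa using hmem s hs 0 le_rfl (by lia)
  -- The support is fixed before `g`, so the rounding error `S.card` does not grow with `g`. The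
  -- shifted copy of `S₁` accommodates `ν (s - 1)`.
  refine ⟨S₁ ∪ S₁.image (· + 1), fun g => ?_⟩
  set c := √(g / B) with hc
  have hc0 : 0 ≤ c := Real.sqrt_nonneg _
  have hcc : c * c * B = g := by
    rw [hc, Real.mul_self_sqrt (by positivity)]
    field_simp
  set ν : ℤ → ℕ := fun s => if s ∈ S₁ then ⌈c * v s⌉₊ else 0 with hν
  have hνw : ∀ s, (ν s : ℝ) ≤ c * v s + 1 := by
    intro s
    simp only [hν]
    split_ifs
    · exact (Nat.ceil_lt_add_one (mul_nonneg hc0 (hv s))).le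
    · have := mul_nonneg hc0 (hv s)
      push_cast
      linarith
  refine ⟨ν, fun s => max (ν s) (ν (s - 1)), fun s => le_max_left _ _, fun s => ?_, fun s hs => ?_,
    fun k h0 hk => ?_, ?_⟩
  · simp
  · have : ν s ≠ 0 ∨ ν (s - 1) ≠ 0 := by grind
    rcases this with h | h
    · refine Finset.mem_union_left _ (by_contra fun h' => h ?_)
      simp [hν, h']
    · refine Finset.mem_union_right _ (Finset.mem_image.2 ⟨s - 1, by_contra fun h' => h ?_, by ring⟩)
      simp [hν, h']
  · have h1 : (g : ℝ) ≤ ((∑ s ∈ S₀, ν s * ν (s + k) : ℕ) : ℝ) := by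
      rw [← hcc]
      push_cast
      calc c * c * B ≤ c * c * ∑ s ∈ S₀, v s * v (s + k) := by
            gcongr
            exact hS₀ k h0 hk
        _ = ∑ s ∈ S₀, (c * v s) * (c * v (s + k)) := by
            rw [Finset.mul_sum]
            exact Finset.sum_congr rfl fun s _ => by ring
        _ ≤ _ := by
            refine Finset.sum_le_sum fun s hs => ?_
            have e1 : c * v s ≤ ν s := by
              simp only [hν, if_pos (hsub hs)]
              exact Nat.le_ceil _
            have e2 : c * v (s + k) ≤ ν (s + k) := by
              simp only [hν, if_pos (hmem s hs k h0 hk)]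
              exact Nat.le_ceil _
            have := hv (s + k)
            gcongr
    refine (Nat.cast_le.1 h1).trans (Finset.sum_le_sum_of_subset ?_)
    exact hsub.trans Finset.subset_union_left
  · push_cast
    calc _ ≤ ∑ s ∈ S₁ ∪ S₁.image (· + 1), (c * w s + 1) := by
          refine Finset.sum_le_sum fun s _ => max_le ?_ ?_
          · exact (hνw s).trans (by gcongr; exact hvw s)
          · exact (hνw _).trans (by gcongr; exact hvw' s)
      _ = c * ∑ s ∈ S₁ ∪ S₁.image (· + 1), w s + (S₁ ∪ S₁.image (· + 1)).card := by
          rw [Finset.sum_add_distrib, Finset.mul_sum]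
          simp
      _ ≤ _ := by
          gcongr
          exact hW _

theorem exists_weights_of_tau_lt {T : ℝ} (hT : tau < ENNReal.ofReal T) :
    ∃ K₀ : ℕ, ∀ K ≥ K₀, ∃ g₀ : ℕ, ∀ g ≥ g₀, ∃ (S : Finset ℤ) (ν μ : ℤ → ℕ),
      (∀ s, ν s ≤ μ s) ∧ (∀ s, ν s ≤ μ (s + 1)) ∧ (∀ s, μ s ≠ 0 → s ∈ S) ∧
      (∀ k : ℤ, 0 ≤ k → k ≤ K → g ≤ ∑ s ∈ S, ν s * ν (s + k)) ∧
      ((∑ s ∈ S, μ s : ℕ) : ℝ) + 1 ≤ T * √(g * K) := by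
  simp only [tau, iInf_lt_iff] at hT
  obtain ⟨f₀, hf₀, hlt₀⟩ := hT
  obtain ⟨f, hf, hfm, hfe⟩ := exists_measurable_mem_autocorrFamily hf₀
  rw [← hfe] at hlt₀
  have hfin : ∫⁻ x, (f x : ℝ≥0∞) ≠ ⊤ := ne_top_of_lt hlt₀
  set I := (∫⁻ x, (f x : ℝ≥0∞)).toReal with hI
  have hI0 : 0 ≤ I := ENNReal.toReal_nonneg
  have hIT : I < T := (ENNReal.lt_ofReal_iff_toReal_lt hfin).1 hlt₀
  -- This `M` gives `(M + 1)² I < T M (M - 1)`, so all window losses fit between `I` and `T`.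
  obtain ⟨M, hM⟩ := exists_nat_gt ((T + 3 * I) / (T - I) + 1)
  have hTI : 0 < T - I := by linarith
  have hM1 : (1 : ℝ) < M := by
    have : 0 ≤ (T + 3 * I) / (T - I) := by apply div_nonneg <;> linarith
    linarith
  have hM2 : (M + 1) ^ 2 * I < T * (M * (M - 1)) := by
    have : T + 3 * I < (T - I) * M := by
      rw [← div_lt_iff₀' hTI]; linarith
    nlinarith
  set T' := (M + 1) ^ 2 * I / (M * (M - 1)) with hT'
  have hMM : (0 : ℝ) < M * (M - 1) := by nlinarith
  have hT'T : T' < T := by rwa [hT', div_lt_iff₀ hMM]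
  refine ⟨M ^ 2 + 1, fun K hK => ?_⟩
  have hK' : (M : ℝ) ^ 2 + 1 ≤ K := by exact_mod_cast hK
  have hK1 : (1 : ℝ) ≤ K := by nlinarith
  have hKM : (0 : ℝ) < (K : ℝ) + M := by linarith
  -- Slightly below the available `M (M - 1) / (K + M)`: the strict inequality allows truncation to
  -- a finite sum.
  set B : ℝ := (M - 1) ^ 2 / (K + M) with hB
  have hM10 : (0 : ℝ) < M - 1 := by linarith
  have hB0 : 0 < B := by positivity
  have hwfin : ∀ M' s, windowMass f (K + M) M' s ≠ ⊤ := fun M' s =>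
    ne_top_of_le_ne_top (ENNReal.mul_ne_top (ENNReal.natCast_ne_top M') hfin)
      ((ENNReal.le_tsum s).trans (tsum_windowMass hfm _ M').le)
  obtain ⟨S₀, hS₀⟩ := exists_finset_lt_sum (Finset.Icc (0 : ℤ) K)
    (fun k s => windowMass f (K + M) M s * windowMass f (K + M) M (s + k)) (ENNReal.ofReal B)
    (fun k hk => by
      rw [Finset.mem_Icc] at hk
      refine lt_of_lt_of_le ?_ (le_tsum_windowMass_mul_windowMass hfm hf
        (by exact_mod_cast one_pos.trans hM1) k hk.1 hk.2)
      rw [ENNReal.ofReal_lt_ofReal_iff (by positivity), hB]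
      gcongr
      nlinarith)
  have hcorr : ∀ k : ℤ, 0 ≤ k → k ≤ K → B ≤ ∑ s ∈ S₀, (windowMass f (K + M) M s).toReal *
      (windowMass f (K + M) M (s + k)).toReal := by
    intro k h0 hk
    have := (hS₀ k (Finset.mem_Icc.2 ⟨h0, hk⟩)).le
    rw [ENNReal.ofReal_le_iff_le_toReal (ENNReal.sum_ne_top.2 fun s _ =>
      ENNReal.mul_ne_top (hwfin _ _) (hwfin _ _)), ENNReal.toReal_sum fun s _ =>
      ENNReal.mul_ne_top (hwfin _ _) (hwfin _ _)] at this
    simpa only [ENNReal.toReal_mul] using this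
  have htot : ∀ S : Finset ℤ, ∑ s ∈ S, (windowMass f (K + M) (M + 1) (s - 1)).toReal ≤
      (M + 1) * I := by
    intro S
    rw [← ENNReal.toReal_sum fun s _ => hwfin _ _]
    have hle : ∑ s ∈ S, windowMass f (K + M) (M + 1) (s - 1) ≤
        ((M + 1 : ℕ) : ℝ≥0∞) * ∫⁻ x, (f x : ℝ≥0∞) := by
      refine (ENNReal.sum_le_tsum S).trans (le_of_eq ?_)
      rw [← tsum_windowMass hfm (K + M)]
      exact (Equiv.subRight (1 : ℤ)).tsum_eq (windowMass f (K + M) (M + 1))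
    have := ENNReal.toReal_mono (ENNReal.mul_ne_top (ENNReal.natCast_ne_top _) hfin) hle
    rw [ENNReal.toReal_mul, ENNReal.toReal_natCast, Nat.cast_add, Nat.cast_one] at this
    exact this
  obtain ⟨S, hS⟩ := exists_nat_weights (K := K) (v := fun s => (windowMass f (K + M) M s).toReal)
    (w := fun s => (windowMass f (K + M) (M + 1) (s - 1)).toReal) (W := (M + 1) * I) hB0
    (fun s => ENNReal.toReal_nonneg)
    (fun s => ENNReal.toReal_mono (hwfin _ _) (windowMass_le_succ_sub_one _ _ _ _))
    (fun s => ENNReal.toReal_mono (hwfin _ _) (windowMass_le_succ _ _ _ _)) S₀ hcorr htot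
  -- From this point on `(T - T') √g` absorbs the rounding error and the `+ 1` of the exceptional
  -- set.
  refine ⟨⌈((S.card + 1) / (T - T')) ^ 2⌉₊, fun g hg => ?_⟩
  obtain ⟨ν, μ, h0, h1, h2, h3, h4⟩ := hS g
  refine ⟨S, ν, μ, h0, h1, h2, h3, ?_⟩
  have hg' : (S.card + 1) / (T - T') ≤ √g := by
    refine Real.le_sqrt_of_sq_le ((Nat.le_ceil _).trans ?_)
    exact_mod_cast hg
  have hTT : 0 < T - T' := by linarith
  rw [div_le_iff₀ hTT] at hg'
  have hK2 : 1 ≤ √K := Real.one_le_sqrt.2 hK1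
  have hsK : √(K + M) * M ≤ √K * (M + 1) := by
    have hl : √(K + M) * M = √((K + M) * M ^ 2) := by
      rw [Real.sqrt_mul hKM.le, Real.sqrt_sq (by linarith)]
    have hr : √K * (M + 1) = √(K * (M + 1) ^ 2) := by
      rw [Real.sqrt_mul (by linarith), Real.sqrt_sq (by linarith)]
    rw [hl, hr]
    refine Real.sqrt_le_sqrt ?_
    nlinarith
  have hΛ : √(g / B) * ((M + 1) * I) ≤ T' * √(g * K) := by
    have e1 : √(g / B) = √g * √(K + M) / (M - 1) := by
      rw [hB, div_div_eq_mul_div, Real.sqrt_div' _ (by positivity), Real.sqrt_sq hM10.le,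
        Real.sqrt_mul (Nat.cast_nonneg g)]
    rw [e1, Real.sqrt_mul (Nat.cast_nonneg g), hT', div_mul_eq_mul_div, div_mul_eq_mul_div,
      div_le_div_iff₀ hM10 hMM]
    have hs : 0 ≤ √(g : ℝ) * (M + 1) * I * (M - 1) := by positivity
    nlinarith [mul_le_mul_of_nonneg_left hsK hs]
  have hsq : √(g * K : ℝ) = √g * √K := Real.sqrt_mul (Nat.cast_nonneg g) _
  have hgs : √(g : ℝ) ≤ √(g * K) := by
    rw [hsq]; exact le_mul_of_one_le_right (Real.sqrt_nonneg _) hK2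
  nlinarith

/-! ### From `p(p-1)K` to all large `N`, and the limits. -/

/-- Bertrand's postulate suffices: a factor of two in `p` is compensated by letting `K = N /
(p(p-1))` vary in the bounded range `[K₀, 16 K₀)`. Only the ratios `p / (p - 1)` and `(K + 1) / K`
are lost, each at most `1 + δ`. -/
theorem eventually_etaRatio_le {T T' : ℝ} (hT : tau < ENNReal.ofReal T) (hTT : T < T') :
    ∃ g₀ : ℕ, ∀ g ≥ g₀, ∀ᶠ N : ℕ in atTop, etaRatio g N ≤ ENNReal.ofReal T' := by
  have hT0 : 0 < T := ENNReal.ofReal_pos.1 (pos_of_gt hT)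
  obtain ⟨δ, hδ, hδT⟩ : ∃ δ : ℝ, 0 < δ ∧ T * (1 + δ) = T' :=
    ⟨(T' - T) / T, div_pos (by linarith) hT0, by field_simp; ring⟩
  obtain ⟨K₁, hK₁⟩ := exists_weights_of_tau_lt hT
  obtain ⟨D, hD⟩ := exists_nat_gt (1 / δ)
  rw [div_lt_iff₀ hδ] at hD
  have hratio : ∀ x : ℝ, D ≤ x - 1 → x ≤ (1 + δ) * (x - 1) := fun x hx => by nlinarith
  set K₀ := K₁ + D + 1 with hK₀
  choose! g₀ hg₀ using hK₁
  -- Only finitely many `K` occur, so one threshold for `g`, and later one for `p`, serves all of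
  -- them.
  refine ⟨(Finset.range (16 * K₀ + 1)).sup g₀ + 1, fun g hg => ?_⟩
  have hgK : ∀ K, K₁ ≤ K → K ≤ 16 * K₀ → ∃ p₀ : ℕ, ∀ p ≥ p₀, p.Prime →
      (eta g (p * (p - 1) * K) : ℝ) ≤ p * (T * √(g * K)) := by
    intro K h1 h2
    have hle : g₀ K ≤ (Finset.range (16 * K₀ + 1)).sup g₀ :=
      Finset.le_sup (Finset.mem_range.2 (by lia))
    obtain ⟨S, ν, μ, h3, h4, h5, h6, h7⟩ := hg₀ K h1 g (by lia)
    obtain ⟨p₀, hp₀⟩ := exists_eta_mul_le g K S ν μ h3 h4 h5 h6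
    refine ⟨p₀, fun p hp hprime => ?_⟩
    calc (eta g (p * (p - 1) * K) : ℝ) ≤ ((p * (∑ s ∈ S, μ s + 1) : ℕ) : ℝ) :=
          Nat.cast_le.2 (hp₀ p hp hprime)
      _ = p * (((∑ s ∈ S, μ s : ℕ) : ℝ) + 1) := by push_cast; ring
      _ ≤ _ := by gcongr
  choose! p₀ hp₀ using hgK
  set P := (Finset.range (16 * K₀ + 1)).sup p₀ + D + 1 with hP
  filter_upwards [eventually_ge_atTop (P * P * (4 * K₀) + 1)] with N hN
  have h4K : 0 < 4 * K₀ := by lia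
  set n := Nat.sqrt (N / (4 * K₀)) with hn
  have hPn : P ≤ n := by
    rw [hn, Nat.le_sqrt, Nat.le_div_iff_mul_le h4K]
    lia
  have hn1 : n * n * (4 * K₀) ≤ N := by
    rw [← Nat.le_div_iff_mul_le h4K]
    exact Nat.sqrt_le _
  have hn2 : N < (n + 1) * (n + 1) * (4 * K₀) := by
    rw [← Nat.div_lt_iff_lt_mul h4K]
    exact Nat.sqrt_lt.1 (Nat.lt_succ_self _)
  obtain ⟨p, hprime, hnp, hp2⟩ := Nat.exists_prime_lt_and_le_two_mul n (by lia)
  set Q := p * (p - 1) with hQ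
  have hQ1 : (n + 1) * n ≤ Q := Nat.mul_le_mul (by lia) (by lia)
  have hQ2 : Q ≤ 4 * (n * n) := by
    calc Q ≤ (2 * n) * (2 * n) := Nat.mul_le_mul hp2 (by lia)
      _ = _ := by ring
  have hQ0 : 0 < Q := lt_of_lt_of_le (by nlinarith) hQ1
  set K := N / Q with hK
  have hKK₀ : K₀ ≤ K := by
    rw [hK, Nat.le_div_iff_mul_le hQ0]
    calc K₀ * Q ≤ K₀ * (4 * (n * n)) := Nat.mul_le_mul_left _ hQ2
      _ = n * n * (4 * K₀) := by ring
      _ ≤ N := hn1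
  have hK16 : K + 1 ≤ 16 * K₀ := by
    have : K < 16 * K₀ := by
      rw [hK, Nat.div_lt_iff_lt_mul hQ0]
      have : (n + 1) * (n + 1) ≤ 2 * ((n + 1) * n) := by nlinarith
      nlinarith
    lia
  have hNlt : N ≤ Q * (K + 1) := by
    have := Nat.lt_mul_div_succ N hQ0
    lia
  have hQK : Q * K ≤ N := Nat.mul_div_le N Q
  have hpp : p₀ (K + 1) ≤ p := by
    have : p₀ (K + 1) ≤ (Finset.range (16 * K₀ + 1)).sup p₀ :=
      Finset.le_sup (Finset.mem_range.2 (by lia))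
    lia
  have hη := hp₀ (K + 1) (by lia) hK16 p hpp hprime
  have hmain : (p : ℝ) * √((K + 1 : ℕ) : ℝ) ≤ (1 + δ) * √N := by
    have e1 : (p : ℝ) ≤ (1 + δ) * (p - 1) := hratio p (by
      have : (D : ℝ) + 1 ≤ p := by exact_mod_cast (by lia : D + 1 ≤ p)
      linarith)
    have e2 : ((K : ℝ) + 1) ≤ (1 + δ) * K := by
      have := hratio (K + 1) (by
        have : (D : ℝ) ≤ K := by exact_mod_cast (by lia : D ≤ K)
        linarith)
      simpa using this
    have e3 : (p : ℝ) * (p - 1) * K ≤ N := by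
      have : ((Q * K : ℕ) : ℝ) ≤ N := Nat.cast_le.2 hQK
      rw [hQ] at this
      push_cast [Nat.cast_sub hprime.one_le] at this
      exact this
    have hp0 : (0 : ℝ) ≤ p := Nat.cast_nonneg p
    have e4 : (p : ℝ) ^ 2 * ((K : ℝ) + 1) ≤ (1 + δ) ^ 2 * N := by
      calc (p : ℝ) ^ 2 * ((K : ℝ) + 1) = p * (p * (K + 1)) := by ring
        _ ≤ p * (((1 + δ) * (p - 1)) * ((1 + δ) * K)) := by
            have := hp0.trans e1
            gcongr
        _ = (1 + δ) ^ 2 * (p * (p - 1) * K) := by ring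
        _ ≤ _ := by gcongr
    have := Real.sqrt_le_sqrt e4
    rw [Real.sqrt_mul (by positivity), Real.sqrt_mul (by positivity), Real.sqrt_sq hp0,
      Real.sqrt_sq (by linarith)] at this
    push_cast
    exact this
  rw [etaRatio]
  have hg0 : (0 : ℝ) < g := by exact_mod_cast (by lia : 0 < g)
  have hN0 : (0 : ℝ) < N := by exact_mod_cast (by lia : 0 < N)
  refine ENNReal.ofReal_le_ofReal ((div_le_iff₀ (Real.sqrt_pos.2 (mul_pos hg0 hN0))).2 ?_)
  calc (eta g N : ℝ) ≤ eta g (Q * (K + 1)) := Nat.cast_le.2 (eta_mono_right g hNlt)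
    _ ≤ p * (T * √(g * (K + 1 : ℕ))) := hη
    _ = T * √g * (p * √((K + 1 : ℕ) : ℝ)) := by rw [Real.sqrt_mul hg0.le]; ring
    _ ≤ T * √g * ((1 + δ) * √N) := by gcongr
    _ = T' * √(g * N) := by rw [Real.sqrt_mul hg0.le, ← hδT]; ring

theorem theorem1p2 :
    tau ≠ ⊤ ∧
    Tendsto (fun g : ℕ => liminf (fun N : ℕ => etaRatio g N) atTop) atTop (𝓝 tau) ∧
    Tendsto (fun g : ℕ => limsup (fun N : ℕ => etaRatio g N) atTop) atTop (𝓝 tau) := by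
  have hlow : ∀ᶠ g : ℕ in atTop, tau ≤ liminf (fun N : ℕ => etaRatio g N) atTop := by
    filter_upwards [eventually_gt_atTop 0] with g hg
    refine le_liminf_of_le (by isBoundedDefault) ?_
    filter_upwards [eventually_gt_atTop 0] with N hN
    exact tau_le_etaRatio hg hN
  have hmid : ∀ g : ℕ, liminf (fun N : ℕ => etaRatio g N) atTop ≤
      limsup (fun N : ℕ => etaRatio g N) atTop := fun g => liminf_le_limsup
  have hup : ∀ a > tau, ∀ᶠ g : ℕ in atTop, limsup (fun N : ℕ => etaRatio g N) atTop < a := by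
    intro a ha
    obtain ⟨b, hb, hba⟩ := exists_between ha
    obtain ⟨c, hc, hcb⟩ := exists_between hb
    have hbt : b ≠ ⊤ := ne_top_of_lt hba
    have hct : c ≠ ⊤ := ne_top_of_lt hcb
    obtain ⟨g₀, hg₀⟩ := eventually_etaRatio_le (T := c.toReal) (T' := b.toReal)
      (by rwa [ENNReal.ofReal_toReal hct]) ((ENNReal.toReal_lt_toReal hct hbt).2 hcb)
    filter_upwards [eventually_ge_atTop g₀] with g hg
    have h := hg₀ g hg
    rw [ENNReal.ofReal_toReal hbt] at h
    exact (limsup_le_of_le (by isBoundedDefault) h).trans_lt hba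
  refine ⟨tau_ne_top, tendsto_order.2 ⟨fun a ha => ?_, fun a ha => ?_⟩,
    tendsto_order.2 ⟨fun a ha => ?_, hup⟩⟩
  · filter_upwards [hlow] with g hg using ha.trans_le hg
  · filter_upwards [hup a ha] with g hg using (hmid g).trans_lt hg
  · filter_upwards [hlow] with g hg using ha.trans_le (hg.trans (hmid g))
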